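/- Let $(\mathcal C,\otimes,1)$ be a semicartesian monoidal category (a monoidal category whose unit is terminal) with equalizers, with projections $\pi_1:A\otimes B\to A\otimes 1\cong A$ and $\pi_2:A\otimes B\to 1\otimes B\cong B$. The pseudo-pullback $A\,{}_f\!\otimes_g B$ of $f:A\to X$ and $g:B\to X$ is the equalizer of $f\circ\pi_1,\ g\circ\pi_2:A\otimes B\to X$; write $p^1,p^2$ for the composites of the equalizer arrow with $\pi_1,\pi_2$. A Grothendieck prelopology $L$ on $\mathcal C$ assigns to each object $U$ a collection $L(U)$ of indexed families of morphisms $\{f_i:U_i\to U\}_{i\in I}$ (covers of $U$) such that: (1) for every isomorphism $f:U'\to U$, the singleton family $\{f\}$ is in $L(U)$; (2) if $\{f_i:U_i\to U\}_{i\in I}\in L(U)$ and $\{g_{ij}:V_{ij}\to U_i\}_{j\in J_i}\in L(U_i)$ for all $i$, then $\{f_i\circ g_{ij}\}_{i\in I,\,j\in J_i}\in L(U)$; (3) if $\{f_i:U_i\to U\}_{i\in I}\in L(U)$ and $V$ is an object, then $\{f_i\otimes \mathrm{id}_V\}_{i\in I}\in L(U\otimes V)$ and $\{\mathrm{id}_V\otimes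 f_i\}_{i\in I}\in L(V\otimes U)$; (4) if $\{f_i:U_i\to U\}_{i\in I}\in L(U)$ and $g:V\to U$ is a morphism, then the families of induced morphisms $\{U_i\,{}_{f_i}\!\otimes_g V\to U\,{}_{\mathrm{id}_U}\!\otimes_g V\}_{i\in I}$ and $\{V\,{}_g\!\otimes_{f_i} U_i\to V\,{}_g\!\otimes_{\mathrm{id}_U}U\}_{i\in I}$ belong to $L(U\,{}_{\mathrm{id}_U}\!\otimes_g V)$ and $L(V\,{}_g\!\otimes_{\mathrm{id}_U}U)$ respectively. A presheaf $F:\mathcal C^{op}\to \mathbf{Set}$ is a sheaf for $L$ if for every cover $\{f_i:U_i\to U\}_{i\in I}\in L(U)$ and every family $x_i\in F(U_i)$ such that $F(p^1)(x_i)=F(p^2)(x_j)$ in $F(U_i\,{}_{f_i}\!\otimes_{f_j}U_j)$ for all $i,j\in I$, there is a unique $x\in F(U)$ with $F(f_i)(x)=x_i$ for all $i\in I$. Let $Sh(\mathcal C,L)$ be the full subcategory of the category of presheaves whose objects are the sheaves for $L$. **Proposition (factorization of morphisms in $Sh(\mathcal C,L)$).** For each morphism $\varphi:F\to G$ in $Sh(\mathcal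 C,L)$ there exists a least element, represented by a monomorphism $\iota:G'\rightarrowtail G$ of $Sh(\mathcal C,L)$, among the subobjects of $G$ in $Sh(\mathcal C,L)$ through which $\varphi$ factors. Thus $\varphi=\iota\circ\varphi'$ for some, necessarily unique, morphism $\varphi':F\to G'$; moreover $\varphi'$ is an epimorphism in $Sh(\mathcal C,L)$. -/

import Mathlib

open CategoryTheory CategoryTheory.Limits MonoidalCategory SemiCartesianMonoidalCategory Opposite

universe t w v u

namespace PrelopologyTheory

noncomputable section

section Projections

variable {C : Type u} [Category.{v} C] [SemiCartesianMonoidalCategory C]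

theorem tensor_fst_whiskerRight {A B V : C} (f : A ⟶ B) : f ▷ V ≫ fst B V = fst A V ≫ f := by
  simp only [fst_def]
  rw [← whisker_exchange_assoc, Category.assoc, rightUnitor_naturality]

theorem tensor_snd_whiskerRight {A B V : C} (f : A ⟶ B) : f ▷ V ≫ snd B V = snd A V := by
  simp only [snd_def, ← comp_whiskerRight_assoc]
  congr 2
  exact isTerminalTensorUnit.hom_ext _ _

theorem tensor_snd_whiskerLeft {A B V : C} (f : A ⟶ B) : V ◁ f ≫ snd V B = snd V A ≫ f := by
  simp only [snd_def]
  rw [whisker_exchange_assoc, Category.assoc, leftUnitor_naturality]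

theorem tensor_fst_whiskerLeft {A B V : C} (f : A ⟶ B) : V ◁ f ≫ fst V B = fst V A := by
  simp only [fst_def, ← whiskerLeft_comp_assoc]
  congr 2
  exact isTerminalTensorUnit.hom_ext _ _

end Projections

section PseudoPullback

variable {C : Type u} [Category.{v} C] [SemiCartesianMonoidalCategory C] [HasEqualizers C]

/-- The pseudo-pullback of `f : A ⟶ X` and `g : B ⟶ X` in a semicartesian monoidal category: the
equalizer of `f ∘ π₁` and `g ∘ π₂`, as morphisms `A ⊗ B ⟶ X`, where `π₁ : A ⊗ B ⟶ A ⊗ 1 ≅ A` and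
`π₂ : A ⊗ B ⟶ 1 ⊗ B ≅ B` are the projections given by terminality of the unit. -/
def pseudoPullback {A B X : C} (f : A ⟶ X) (g : B ⟶ X) : C :=
  equalizer (fst A B ≫ f) (snd A B ≫ g)

/-- The equalizer arrow of the pseudo-pullback into the tensor product. -/
def pseudoPullbackι {A B X : C} (f : A ⟶ X) (g : B ⟶ X) : pseudoPullback f g ⟶ A ⊗ B :=
  equalizer.ι (fst A B ≫ f) (snd A B ≫ g)

/-- The first projection `p₁` of the pseudo-pullback. -/
def pseudoPullbackFst {A B X : C} (f : A ⟶ X) (g : B ⟶ X) : pseudoPullback f g ⟶ A :=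
  pseudoPullbackι f g ≫ fst A B

/-- The second projection `p₂` of the pseudo-pullback. -/
def pseudoPullbackSnd {A B X : C} (f : A ⟶ X) (g : B ⟶ X) : pseudoPullback f g ⟶ B :=
  pseudoPullbackι f g ≫ snd A B

/-- For `f : A ⟶ X` and `g : V ⟶ X`, the morphism from the pseudo-pullback of `f` and `g` to that
of `𝟙 X` and `g` induced by `f ⊗ 𝟙 V` through the universal property of the equalizer. -/
def pseudoPullbackRight {A V X : C} (f : A ⟶ X) (g : V ⟶ X) :
    pseudoPullback f g ⟶ pseudoPullback (𝟙 X) g :=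
  equalizer.lift (pseudoPullbackι f g ≫ f ▷ V) (by
    simp only [Category.assoc, Category.comp_id, tensor_fst_whiskerRight]
    rw [← Category.assoc (f ▷ V), tensor_snd_whiskerRight]
    exact equalizer.condition _ _)

/-- For `g : V ⟶ X` and `f : A ⟶ X`, the morphism from the pseudo-pullback of `g` and `f` to that
of `g` and `𝟙 X` induced by `𝟙 V ⊗ f` through the universal property of the equalizer. -/
def pseudoPullbackLeft {A V X : C} (g : V ⟶ X) (f : A ⟶ X) :
    pseudoPullback g f ⟶ pseudoPullback g (𝟙 X) :=
  equalizer.lift (pseudoPullbackι g f ≫ V ◁ f) (by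
    simp only [Category.assoc, Category.comp_id, tensor_snd_whiskerLeft]
    rw [← Category.assoc (V ◁ f), tensor_fst_whiskerLeft]
    exact equalizer.condition _ _)

end PseudoPullback

/-- A Grothendieck prelopology on a semicartesian monoidal category with equalizers. Covers are
indexed families, not sets of arrows: repeating an arrow in a family can change the condition that
the family imposes on sheaves. -/
structure Prelopology (C : Type u) [Category.{v} C] [SemiCartesianMonoidalCategory C]
    [HasEqualizers C] where
  /-- `Covers f` says that the family `f` of morphisms into `U` belongs to `L(U)`. -/
  Covers : ∀ {U : C} {I : Type t} {X : I → C}, (∀ i, X i ⟶ U) → Prop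
  iso_covers : ∀ {U' U : C} (f : U' ⟶ U) [IsIso f], Covers (fun _ : PUnit.{t + 1} => f)
  comp_covers : ∀ {U : C} {I : Type t} {X : I → C} (f : ∀ i, X i ⟶ U)
    {J : I → Type t} {Y : ∀ i, J i → C} (g : ∀ i j, Y i j ⟶ X i),
    Covers f → (∀ i, Covers (g i)) →
      Covers (fun k : (Σ i, J i) => g k.1 k.2 ≫ f k.1)
  whiskerRight_covers : ∀ {U : C} {I : Type t} {X : I → C} (f : ∀ i, X i ⟶ U),
    Covers f → ∀ V : C, Covers (fun i => f i ▷ V)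
  whiskerLeft_covers : ∀ {U : C} {I : Type t} {X : I → C} (f : ∀ i, X i ⟶ U),
    Covers f → ∀ V : C, Covers (fun i => V ◁ f i)
  pseudoPullbackRight_covers : ∀ {U : C} {I : Type t} {X : I → C} (f : ∀ i, X i ⟶ U),
    Covers f → ∀ {V : C} (g : V ⟶ U), Covers (fun i => pseudoPullbackRight (f i) g)
  pseudoPullbackLeft_covers : ∀ {U : C} {I : Type t} {X : I → C} (f : ∀ i, X i ⟶ U),
    Covers f → ∀ {V : C} (g : V ⟶ U), Covers (fun i => pseudoPullbackLeft g (f i))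

section Sheaves

variable {C : Type u} [Category.{v} C] [SemiCartesianMonoidalCategory C] [HasEqualizers C]

/-- A family `x i ∈ F(X i)` is compatible for `f` if `x i` and `x j` agree on the pseudo-pullback
of `f i` and `f j`, for all `i` and `j` (`i = j` included). -/
def Compatible (F : Cᵒᵖ ⥤ Type w) {U : C} {I : Type t} {X : I → C} (f : ∀ i, X i ⟶ U)
    (x : ∀ i, F.obj (op (X i))) : Prop :=
  ∀ i j, F.map (pseudoPullbackFst (f i) (f j)).op (x i) =
    F.map (pseudoPullbackSnd (f i) (f j)).op (x j)

/-- A presheaf is a sheaf for `L` if every compatible family for a cover has a unique gluing. -/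
def IsSheaf (L : Prelopology.{t} C) (F : Cᵒᵖ ⥤ Type w) : Prop :=
  ∀ {U : C} {I : Type t} {X : I → C} (f : ∀ i, X i ⟶ U), L.Covers f →
    ∀ x : (∀ i, F.obj (op (X i))), Compatible F f x →
      ∃! s : F.obj (op U), ∀ i, F.map (f i).op s = x i

/-- The property of presheaves of being a sheaf for `L`. -/
def isSheafProperty (L : Prelopology.{t} C) : ObjectProperty (Cᵒᵖ ⥤ Type w) :=
  fun F => IsSheaf L F

/-- The category `Sh(C, L)`: the full subcategory of presheaves on the sheaves for `L`. -/
abbrev Sh (L : Prelopology.{t} C) : Type (max u v (w + 1)) :=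
  (isSheafProperty.{t, w} L).FullSubcategory

end Sheaves

end

end PrelopologyTheory

/-! Call a subpresheaf of a sheaf closed if membership in it can be tested on a cover. Closed
subpresheaves are sheaves and are stable under intersection, so `G'` is taken to be the intersection
of all closed subpresheaves of `G` containing the range of `φ`. Minimality: a monomorphism of
sheaves is pointwise injective (`Sh.injective_of_mono`), and its range is then closed
(`isClosedSubfunctor_range`). So any subobject through which `φ` factors has a closed range
containing that of `φ`, hence containing `G'`. Epimorphism: two maps from `G'` to a sheaf that agree
on `F` have a closed equalizer containing the range of `φ`, which by minimality is all of `G'`. -/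

namespace PrelopologyTheory

section

variable {C : Type u} [Category.{v} C] {F G : Cᵒᵖ ⥤ Type w}

/-- The kernel pair of a morphism of presheaves. -/
def kernelPair (a : F ⟶ G) : Cᵒᵖ ⥤ Type w where
  obj V := { p : F.obj V × F.obj V // a.app V p.1 = a.app V p.2 }
  map k := ↾fun p => ⟨(F.map k p.1.1, F.map k p.1.2), by
    simp only [NatTrans.naturality_apply, p.2]⟩

/-- The first projection of the kernel pair. -/
def kernelPairFst (a : F ⟶ G) : kernelPair a ⟶ F where
  app _ := ↾fun p => p.1.1

/-- The second projection of the kernel pair. -/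
def kernelPairSnd (a : F ⟶ G) : kernelPair a ⟶ F where
  app _ := ↾fun p => p.1.2

theorem kernelPair_condition (a : F ⟶ G) : kernelPairFst a ≫ a = kernelPairSnd a ≫ a := by
  ext V p
  exact p.2

end

section

variable {C : Type u} [Category.{v} C] [SemiCartesianMonoidalCategory C] [HasEqualizers C]

theorem pseudoPullback_condition {A B X : C} (f : A ⟶ X) (g : B ⟶ X) :
    pseudoPullbackFst f g ≫ f = pseudoPullbackSnd f g ≫ g := by
  simp only [pseudoPullbackFst, pseudoPullbackSnd, Category.assoc]
  exact equalizer.condition (fst A B ≫ f) (snd A B ≫ g)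

variable {L : Prelopology.{t} C} {F G H : Cᵒᵖ ⥤ Type w}

theorem compatible_restrict (F : Cᵒᵖ ⥤ Type w) {U : C} {I : Type t} {X : I → C}
    (f : ∀ i, X i ⟶ U) (s : F.obj (op U)) : Compatible F f (fun i => F.map (f i).op s) := by
  intro i j
  simp only [← Functor.map_comp_apply, ← op_comp, pseudoPullback_condition]

theorem IsSheaf.section_ext (hF : IsSheaf L F) {U : C} {I : Type t} {X : I → C}
    {f : ∀ i, X i ⟶ U} (hf : L.Covers f) {s s' : F.obj (op U)}
    (h : ∀ i, F.map (f i).op s = F.map (f i).op s') : s = s' :=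
  (hF f hf _ (compatible_restrict F f s')).unique h fun _ => rfl

/-- A natural transformation preserves compatible families. -/
theorem Compatible.map {U : C} {I : Type t} {X : I → C} {f : ∀ i, X i ⟶ U}
    {x : ∀ i, F.obj (op (X i))} (hx : Compatible F f x) (a : F ⟶ G) :
    Compatible G f (fun i => a.app _ (x i)) := by
  intro i j
  simp only [← NatTrans.naturality_apply, hx i j]

/-- A pointwise injective natural transformation reflects compatible families. -/
theorem Compatible.of_map {U : C} {I : Type t} {X : I → C} {f : ∀ i, X i ⟶ U}
    {x : ∀ i, F.obj (op (X i))} {a : F ⟶ G} (ha : ∀ V, Function.Injective (a.app V))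
    (hx : Compatible G f (fun i => a.app _ (x i))) : Compatible F f x := by
  intro i j
  apply ha
  simp only [NatTrans.naturality_apply, hx i j]

/-- A subpresheaf is closed for `L` if it contains every section that lies in it locally. -/
def IsClosedSubfunctor (L : Prelopology.{t} C) (S : Subfunctor F) : Prop :=
  ∀ {U : C} {I : Type t} {X : I → C} (f : ∀ i, X i ⟶ U), L.Covers f →
    ∀ s : F.obj (op U), (∀ i, F.map (f i).op s ∈ S.obj (op (X i))) → s ∈ S.obj (op U)

/-- Glue in `F`; closedness puts the gluing back in `S`. -/
theorem IsClosedSubfunctor.isSheaf {S : Subfunctor F} (hS : IsClosedSubfunctor L S)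
    (hF : IsSheaf L F) : IsSheaf L S.toFunctor := by
  intro U I X f hf x hx
  obtain ⟨s, hs, -⟩ := hF f hf _ (hx.map S.ι)
  have hmem : s ∈ S.obj (op U) := hS f hf s fun i => by
    rw [hs i]
    exact (x i).2
  refine ⟨⟨s, hmem⟩, fun i => Subtype.ext (hs i), fun r hr => Subtype.ext ?_⟩
  exact hF.section_ext hf fun i => (congrArg Subtype.val (hr i)).trans (hs i).symm

theorem isClosedSubfunctor_sInf {T : Set (Subfunctor F)}
    (hT : ∀ S ∈ T, IsClosedSubfunctor L S) : IsClosedSubfunctor L (sInf T) := by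
  rintro U I X f hf s hs _ ⟨S, hS, rfl⟩
  exact hT S hS f hf s fun i => hs i _ ⟨S, hS, rfl⟩

/-- Injectivity makes the chosen local preimages compatible, so they glue in `F`. -/
theorem isClosedSubfunctor_range (hF : IsSheaf L F) (hG : IsSheaf L G) (a : F ⟶ G)
    (ha : ∀ V, Function.Injective (a.app V)) : IsClosedSubfunctor L (Subfunctor.range a) := by
  intro U I X f hf s hs
  choose x hx using hs
  have hc : Compatible F f x := by
    refine Compatible.of_map ha ?_
    simp only [hx]
    exact compatible_restrict G f s
  obtain ⟨r, hr, -⟩ := hF f hf x hc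
  refine ⟨r, hG.section_ext hf fun i => ?_⟩
  rw [← NatTrans.naturality_apply, hr i, hx i]

theorem isClosedSubfunctor_equalizer {S : Subfunctor F} (hS : IsClosedSubfunctor L S)
    (hG : IsSheaf L G) (a b : S.toFunctor ⟶ G) :
    IsClosedSubfunctor L (Subfunctor.equalizer a b) := by
  intro U I X f hf s hs
  have hmem : s ∈ S.obj (op U) := hS f hf s fun i => (hs i).1
  refine ⟨hmem, hG.section_ext hf fun i => ?_⟩
  let y : S.toFunctor.obj (op U) := ⟨s, hmem⟩
  exact (NatTrans.naturality_apply a (f i).op y).symm.trans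
    ((hs i).2.trans (NatTrans.naturality_apply b (f i).op y))

/-- The two components glue separately in `F`; their images in `G` agree locally, hence globally. -/
theorem isSheaf_kernelPair (hF : IsSheaf L F) (hG : IsSheaf L G) (a : F ⟶ G) :
    IsSheaf L (kernelPair a) := by
  intro U I X f hf x hx
  obtain ⟨s, hs, -⟩ := hF f hf _ (hx.map (kernelPairFst a))
  obtain ⟨r, hr, -⟩ := hF f hf _ (hx.map (kernelPairSnd a))
  have h : a.app _ s = a.app _ r := hG.section_ext hf fun i => by
    rw [← NatTrans.naturality_apply, ← NatTrans.naturality_apply, hs i, hr i]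
    exact (x i).2
  refine ⟨⟨(s, r), h⟩, fun i => Subtype.ext (Prod.ext (hs i) (hr i)), fun q hq => ?_⟩
  refine Subtype.ext (Prod.ext (hF.section_ext hf fun i => ?_) (hF.section_ext hf fun i => ?_))
  · exact (congrArg (fun p => p.1.1) (hq i)).trans (hs i).symm
  · exact (congrArg (fun p => p.1.2) (hq i)).trans (hr i).symm

/-- The kernel pair is itself a sheaf, so cancelling `a` in `Sh` identifies its two projections;
evaluating them at `(s, r)` gives `s = r`. -/
theorem Sh.injective_of_mono {F G : Sh.{t, w} L} (a : F ⟶ G) [Mono a] (V : Cᵒᵖ) :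
    Function.Injective (a.hom.app V) := by
  intro s r h
  let K : Sh.{t, w} L := ⟨kernelPair a.hom, isSheaf_kernelPair F.property G.property a.hom⟩
  let p : K ⟶ F := ObjectProperty.homMk (kernelPairFst a.hom)
  let q : K ⟶ F := ObjectProperty.homMk (kernelPairSnd a.hom)
  have hpq : p = q := by
    rw [← cancel_mono a]
    exact ObjectProperty.hom_ext _ (kernelPair_condition a.hom)
  exact congrArg (fun k : K ⟶ F => k.hom.app V ⟨(s, r), h⟩) hpq

/-- The sheaf given by a closed subpresheaf of a sheaf. -/
abbrev Sh.ofClosed (G : Sh.{t, w} L) {S : Subfunctor G.obj} (hS : IsClosedSubfunctor L S) :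
    Sh.{t, w} L :=
  ⟨S.toFunctor, hS.isSheaf G.property⟩

/-- The least closed subpresheaf of `G` that contains the range of `a`. -/
def closedRange (L : Prelopology.{t} C) (a : F ⟶ G) : Subfunctor G :=
  sInf { S | IsClosedSubfunctor L S ∧ Subfunctor.range a ≤ S }

theorem isClosedSubfunctor_closedRange (a : F ⟶ G) : IsClosedSubfunctor L (closedRange L a) :=
  isClosedSubfunctor_sInf fun _ h => h.1

theorem range_le_closedRange (a : F ⟶ G) : Subfunctor.range a ≤ closedRange L a :=
  le_sInf fun _ h => h.2

theorem closedRange_le {a : F ⟶ G} {S : Subfunctor G} (hS : IsClosedSubfunctor L S)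
    (h : Subfunctor.range a ≤ S) : closedRange L a ≤ S :=
  sInf_le ⟨hS, h⟩

theorem hom_ext_of_closedRange (hH : IsSheaf L H) (a : F ⟶ G)
    (b : F ⟶ (closedRange L a).toFunctor) (hb : b ≫ (closedRange L a).ι = a)
    {c d : (closedRange L a).toFunctor ⟶ H} (h : b ≫ c = b ≫ d) : c = d := by
  rw [← Subfunctor.equalizer_eq_iff]
  refine le_antisymm (Subfunctor.equalizer_le c d) (closedRange_le ?_ ?_)
  · exact isClosedSubfunctor_equalizer (isClosedSubfunctor_closedRange a) hH c d
  · rw [← Subfunctor.range_le_equalizer_iff, hb] at h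
    exact h

end

end PrelopologyTheory

open PrelopologyTheory in
theorem mainTheorem10 {C : Type u} [Category.{v} C] [SemiCartesianMonoidalCategory C]
    [HasEqualizers C] (L : PrelopologyTheory.Prelopology.{t} C)
    {F G : PrelopologyTheory.Sh.{t, w} L} (φ : F ⟶ G) :
    ∃ (G' : PrelopologyTheory.Sh.{t, w} L) (ι : G' ⟶ G) (_ : Mono ι),
      IsLeast {P : Subobject G | P.Factors φ} (Subobject.mk ι) ∧
      (∃! φ' : F ⟶ G', φ' ≫ ι = φ) ∧
      ∀ φ' : F ⟶ G', φ' ≫ ι = φ → Epi φ' := by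
  let S : Subfunctor G.obj := closedRange L φ.hom
  let G' : Sh.{t, w} L := Sh.ofClosed G (S := S) (isClosedSubfunctor_closedRange φ.hom)
  let ι : G' ⟶ G := ObjectProperty.homMk S.ι
  have hι : Mono ι := ⟨fun a b h => ObjectProperty.hom_ext _ <| by
    rw [← cancel_mono S.ι]
    exact congrArg InducedCategory.Hom.hom h⟩
  have hφ : Subfunctor.range φ.hom ≤ S := range_le_closedRange φ.hom
  let ψ : F ⟶ G' := ObjectProperty.homMk (Subfunctor.lift (G := S) φ.hom hφ)
  have hψ : ψ ≫ ι = φ := ObjectProperty.hom_ext _ (Subfunctor.lift_ι φ.hom hφ)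
  refine ⟨G', ι, hι, ⟨?_, fun P hP => ?_⟩, ⟨ψ, hψ, fun χ hχ => ?_⟩, fun χ hχ => ⟨fun {H} c d h => ?_⟩⟩
  · exact (Subobject.mk_factors_iff ι φ).2 ⟨ψ, hψ⟩
  · have hinj := Sh.injective_of_mono P.arrow
    have hle : S ≤ Subfunctor.range P.arrow.hom := by
      refine closedRange_le (isClosedSubfunctor_range (P : Sh.{t, w} L).property G.property _
        hinj) ?_
      have h : (P.factorThru φ hP).hom ≫ P.arrow.hom = φ.hom :=
        congrArg InducedCategory.Hom.hom (P.factorThru_arrow φ hP)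
      rw [← h]
      exact Subfunctor.range_comp_le _ _
    -- Monicity as a map of presheaves makes `toRange` an isomorphism; its inverse carries the range
    -- back to `P`.
    have : Mono P.arrow.hom :=
      @NatTrans.mono_of_mono_app _ _ _ _ _ _ _ fun V => (mono_iff_injective _).2 (hinj V)
    refine Subobject.mk_le_of_comm (ObjectProperty.homMk
      (Subfunctor.homOfLe hle ≫ inv (Subfunctor.toRange P.arrow.hom))) ?_
    apply ObjectProperty.hom_ext
    change (Subfunctor.homOfLe hle ≫ inv (Subfunctor.toRange P.arrow.hom)) ≫ P.arrow.hom = S.ι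
    rw [Category.assoc, ← Subfunctor.homOfLe_ι hle]
    congr 1
    rw [IsIso.inv_comp_eq, Subfunctor.toRange_ι]
  · rw [← cancel_mono ι, hχ, hψ]
  · apply ObjectProperty.hom_ext
    exact hom_ext_of_closedRange H.property φ.hom χ.hom
      (congrArg InducedCategory.Hom.hom hχ) (congrArg InducedCategory.Hom.hom h)
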